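/- **Setting.** Let $f:\mathbb R^n\times\mathbb R^m\times\mathbb R^q\to\mathbb R^n$ and $\pi:\mathbb R^n\times\mathbb R^m\to\mathbb R^m$, and put $f_\pi(x,v,w)=f(x,\pi(x,v),w)$. Let $\mathbb Z\subseteq\mathbb R^n\times\mathbb R^m$ and $\mathbb W\subseteq\mathbb R^q$ be compact and convex with nonempty interior, $0\in\operatorname{int}\mathbb W$. Put $\mathbb Z_\pi=\{(x,v):(x,\pi(x,v))\in\mathbb Z\}$. Let $\Omega\subseteq\mathbb R^n$ be compact and robust control invariant, i.e. $f_\pi(x,v,w)-f_\pi(z,v,0)\in\Omega$ whenever $x-z\in\Omega$, $(x,v)\in\mathbb Z_\pi$, $w\in\mathbb W$. Put $\overline{\mathbb Z}=\{(z,v):(z+\epsilon,v)\in\mathbb Z_\pi\ \forall\epsilon\in\Omega\}$. Suppose $\Omega$ and $\overline{\mathbb Z}$ have nonempty interior. *Stage cost.* Let $L:\mathbb R^n\times\mathbb R^m\to\mathbb R$ be continuous, $L_\pi(x,v)=L(x,\pi(x,v))$, and let $\ell$ be one of $L_\pi(z,v)$, $\int_\Omega L_\pi(z+\epsilon,v)\,d\epsilon$,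 $\max_{\epsilon\in\Omega}L_\pi(z+\epsilon,v)$ (assumed well defined). Suppose $\ell$ is Lipschitz continuous on $\mathbb Z_\pi\cup\overline{\mathbb Z}$ (this set is $\mathbb Z_\pi$ if $0\in\Omega$). *Steady state.* Let $(z_s,v_s)\in\operatorname{int}\overline{\mathbb Z}$ minimize $\ell$ over $\{(z,v)\in\overline{\mathbb Z}:z=f_\pi(z,v,0)\}$. *Nominal problem.* For an input sequence $v$ let $\phi(t,z,v)$ be the solution of $z(t+1)=f_\pi(z(t),v(t),0)$, $z(0)=z$, and let $J_T(z,v)=\sum_{t=0}^{T-1}\ell(\phi(t,z,v),v(t))$. Given $X_f\subseteq\mathbb R^n$ and $V_f:\mathbb R^n\to\mathbb R$, let $V_N(z)$ be the minimum of $J_N(z,v)+V_f(\phi(N,z,v))$ over all $v$ with $(\phi(t,z,v),v(t))\in\overline{\mathbb Z}$ for $t<N$ and $\phi(N,z,v)\in X_f$. Let $\mathbb X_N$ be the set of all $z$ for which there are $(\tilde z,\tilde v):\mathbb N_0\to\overline{\mathbb Z}$ with $\tilde z(0)=z$, $\tilde z(t+1)=f_\pi(\tilde z(t),\tilde v(t),0)$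 for $t<N$, and $\tilde z(N)\in X_f$. Suppose that minimizers exist for all $N\ge1$ and fix one, $v_N^*(\cdot;z)$, for each $z\in\mathbb X_N$; suppose also that for every $x\in\mathbb X_N\oplus\Omega$ the minimum of $V_N(z)$ over $z\in\mathbb X_N$ with $x-z\in\Omega$ is attained, and fix a minimizer $z^*_{0}(x)$ (depending on $N$). *Closed loop.* Let $Z_N^{cl}(z)=\{z^*_{0}(x):x\in\{f_\pi(z,v_N^*(0;z),0)\}\oplus\Omega\}$. A closed-loop nominal sequence for horizon $N$ is a sequence $z_N(0|t)$, $t\ge0$, with $z_N(0|0)\in\mathbb X_N$ and $z_N(0|t+1)\in Z^{cl}_N(z_N(0|t))$. Its cost is $J_T^{cl}=\sum_{t=0}^{T-1}\ell\big(z_N(0|t),v_N^*(0;z_N(0|t))\big)$. *Comparison functions.* $\mathcal K$: continuous strictly increasing $\alpha:\mathbb R_{\ge0}\to\mathbb R_{\ge0}$ with $\alpha(0)=0$; $\mathcal K_\infty$: unbounded functions in $\mathcal K$; $\mathcal L$: continuous strictly decreasing $\delta:\mathbb R_{\ge0}\to\mathbb R_{\ge0}$ with $\delta(t)\to0$ as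 $t\to\infty$; $\mathcal{KL}$: functions $\beta:\mathbb R_{\ge0}^2\to\mathbb R_{\ge0}$ with $\beta(\cdot,t)\in\mathcal K$ for all $t\ge0$ and $\beta(r,\cdot)\in\mathcal L$ for all $r>0$. **Assumptions.** 1. *Terminal conditions.* $X_f$ is closed, $z_s\in\operatorname{int}X_f$, $V_f$ is continuous on $X_f$, and there is $\kappa_f:X_f\to\mathbb R^m$ such that for all $z\in X_f$: $(z,\kappa_f(z))\in\overline{\mathbb Z}$, $f_\pi(z,\kappa_f(z),0)\in X_f$, and $V_f(f_\pi(z,\kappa_f(z),0))-V_f(z)\le-\ell(z,\kappa_f(z))+\ell(z_s,v_s)$. 2. *Strict dissipativity.* There are a bounded $\lambda:\mathbb R^n\to\mathbb R$ and $\alpha_\ell\in\mathcal K_\infty$ such that $\lambda(f_\pi(z,v,0))-\lambda(z)\le\ell(z,v)-\ell(z_s,v_s)-\alpha_\ell(\|(z,v)-(z_s,v_s)\|)$ for all $(z,v)\in\overline{\mathbb Z}$; and, with the same $\lambda,\alpha_\ell$, for all $N\ge1$, $z\in\mathbb X_N$ and $y\in Z_N^{cl}(z)$, $\lambda(y)-\lambda(z)\le\ell(z,v)-\ell(z_s,v_s)-\alpha_\ell(\|(z,v)-(z_s,v_s)\|)$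 with $v=v_N^*(0;z)$. 3. *Exponential reachability.* For all $N\ge1$ and $z\in\mathbb X_N$ there are an input sequence $v$ with $(\phi(t,z,v),v(t))\in\overline{\mathbb Z}$ for all $t\geq 0$ and $c>0$, $\rho\in[0,1)$ with $\|(\phi(t,z,v),v(t))-(z_s,v_s)\|\le c\rho^t$ for all $t\ge0$. 4. *Local $M$-step controllability at $(z_s,v_s)$.* There is $M\in\mathbb N_0$ such that for every $\varepsilon>0$ there is $r>0$ such that for all $y,z\in\mathbb R^n$ with $\|y-z_s\|\le r$, $\|z-z_s\|\le r$ there is $v$ with $\phi(M,y,v)=z$ and $\|(\phi(t,y,v),v(t))-(z_s,v_s)\|\le\varepsilon$ for all $t<M$. 5. *Continuity of the value functions.* There is $\alpha_V\in\mathcal K_\infty$ with $|V_N(z)-V_N(z_s)|\le\alpha_V(\|z-z_s\|)$ for all $N\ge1$, $z\in\mathbb X_N$. **Theorem (transient performance with terminal conditions).** There exists $\beta\in\mathcal{KL}$ such that $$\|z_N(0|t)-z_s\|\le\beta(\|z_N(0|0)-z_s\|,t)\qquad(*)$$ for all $N\ge1$, all closed-loop nominal sequences for horizon $N$ and all $t\in\mathbb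 N_0$. Moreover, for every $\beta\in\mathcal{KL}$ with $(*)$ there are $\delta_1,\delta_2\in\mathcal L$ such that, for all $N\ge1$, all $T\in\mathbb N_0$ and all closed-loop nominal sequences for horizon $N$, $$J_T^{cl}\le\inf_{v}J_T(z_N(0|0),v)+\delta_1(N)+\delta_2(T),$$ where the infimum ($+\infty$ over the empty set) is over all $v$ with $(\phi(t,z_N(0|0),v),v(t))\in\overline{\mathbb Z}$ for $t<T$ and $\|\phi(T,z_N(0|0),v)-z_s\|\le\kappa$, with $\kappa=\beta(\|z_N(0|0)-z_s\|,T)$. -/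

import Mathlib

open Filter Topology
open scoped NNReal

noncomputable section

/-- Real coordinate space with the Euclidean norm. -/
abbrev EVec (d : ℕ) : Type := EuclideanSpace ℝ (Fin d)

/-! ### Comparison functions -/

/-- Class `K`. -/
def IsClassK (α : ℝ≥0 → ℝ≥0) : Prop :=
  Continuous α ∧ StrictMono α ∧ α 0 = 0

/-- Class `K∞`: the unbounded functions of class `K`. -/
def IsClassKInf (α : ℝ≥0 → ℝ≥0) : Prop :=
  IsClassK α ∧ ∀ b : ℝ≥0, ∃ r : ℝ≥0, b < α r

/-- Class `L`: continuous, strictly decreasing, with limit zero. -/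
def IsClassL (δ : ℝ≥0 → ℝ≥0) : Prop :=
  Continuous δ ∧ StrictAnti δ ∧ Tendsto δ atTop (𝓝 0)

/-- Class `KL`. The requirement on `β r ·` is made for `r > 0`, since `β 0 · = 0` by the
first requirement. -/
def IsClassKL (β : ℝ≥0 → ℝ≥0 → ℝ≥0) : Prop :=
  (∀ t, IsClassK fun r => β r t) ∧ ∀ r, 0 < r → IsClassL (β r)

/-! ### Data of the tube-based scheme -/

/-- The data of a tube-based economic MPC scheme with terminal conditions (no properties are
imposed here). -/
structure TubeMPC (n m q : ℕ) where
  /-- state transition map -/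
  f : EVec n → EVec m → EVec q → EVec n
  /-- parametrized feedback -/
  fb : EVec n → EVec m → EVec m
  /-- state and input constraint set -/
  con : Set (EVec n × EVec m)
  /-- disturbance set -/
  dist : Set (EVec q)
  /-- robust control invariant set -/
  Ω : Set (EVec n)
  /-- original stage cost -/
  L : EVec n × EVec m → ℝ
  /-- stage cost used by the controller -/
  ell : EVec n × EVec m → ℝ
  /-- terminal region -/
  Xf : Set (EVec n)
  /-- terminal cost -/
  Vf : EVec n → ℝ
  /-- state of the robust optimal steady state -/
  zs : EVec n
  /-- input of the robust optimal steady state -/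
  vs : EVec m
  /-- `vOpt N z` is the selected optimal input sequence for horizon `N` from `z` -/
  vOpt : ℕ → EVec n → ℕ → EVec m
  /-- `zOpt N x` is the selected optimal nominal initial state for the measured state `x` -/
  zOpt : ℕ → EVec n → EVec n

namespace TubeMPC

variable {n m q : ℕ} (S : TubeMPC n m q)

/-- Dynamics under the parametrized feedback. -/
def fPi (x : EVec n) (v : EVec m) (w : EVec q) : EVec n := S.f x (S.fb x v) w

/-- Constraint set in the variables `(x, v)`. -/
def conPi : Set (EVec n × EVec m) := {p | (p.1, S.fb p.1 p.2) ∈ S.con}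

/-- Tightened constraint set for the nominal state and the input. -/
def tight : Set (EVec n × EVec m) := {p | ∀ e ∈ S.Ω, (p.1 + e, p.2) ∈ S.conPi}

/-- Robust control invariance of `Ω` for the error system. -/
def IsRCI : Prop :=
  IsCompact S.Ω ∧ ∀ (x z : EVec n) (v : EVec m), x - z ∈ S.Ω → (x, v) ∈ S.conPi →
    ∀ w ∈ S.dist, S.fPi x v w - S.fPi z v 0 ∈ S.Ω

/-- The original stage cost under the parametrized feedback. -/
def LPi (p : EVec n × EVec m) : ℝ := S.L (p.1, S.fb p.1 p.2)

/-- Euclidean distance of `(z, v)` to the steady state `(zs, vs)`. -/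
def ssDist (z : EVec n) (v : EVec m) : ℝ≥0 := ‖WithLp.toLp 2 (z - S.zs, v - S.vs)‖₊

/-- The points at which the stage cost is evaluated (this is just `conPi` when `0 ∈ Ω`). -/
def costDomain : Set (EVec n × EVec m) := S.conPi ∪ S.tight

/-- `ell` is one of the three stage costs: nominal, averaged over `Ω`, worst case over `Ω`
(the integral and the maximum being well defined). -/
def IsStageCost : Prop :=
  (∀ p ∈ S.costDomain, S.ell p = S.LPi p) ∨
  (∀ p ∈ S.costDomain,
    MeasureTheory.IntegrableOn (fun e => S.LPi (p.1 + e, p.2)) S.Ω ∧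
      S.ell p = ∫ e in S.Ω, S.LPi (p.1 + e, p.2)) ∨
  (∀ p ∈ S.costDomain,
    IsGreatest ((fun e => S.LPi (p.1 + e, p.2)) '' S.Ω) (S.ell p))

/-! ### Nominal optimal control problem -/

/-- Solution of the nominal system from `z` under the input sequence `v`. -/
def traj (z : EVec n) (v : ℕ → EVec m) : ℕ → EVec n
  | 0 => z
  | t + 1 => S.fPi (traj z v t) (v t) 0

/-- Admissible input sequences over the horizon `T` (only `v 0, …, v (T - 1)` matter). -/
def admissible (T : ℕ) (z : EVec n) : Set (ℕ → EVec m) :=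
  {v | ∀ t < T, (S.traj z v t, v t) ∈ S.tight}

/-- Admissible input sequences that steer the nominal state into the closed ball of radius `κ`
around `zs` in time `T`. -/
def admissibleToBall (κ : ℝ) (T : ℕ) (z : EVec n) : Set (ℕ → EVec m) :=
  {v ∈ S.admissible T z | ‖S.traj z v T - S.zs‖ ≤ κ}

/-- Open-loop cost `J_T`. -/
def J (T : ℕ) (z : EVec n) (v : ℕ → EVec m) : ℝ :=
  ∑ t ∈ Finset.range T, S.ell (S.traj z v t, v t)

/-- Inputs satisfying all constraints of the problem with horizon `N`, including the terminal
one. -/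
def feasibleInputs (N : ℕ) (z : EVec n) : Set (ℕ → EVec m) :=
  {v ∈ S.admissible N z | S.traj z v N ∈ S.Xf}

/-- Objective of the problem with horizon `N`. -/
def objective (N : ℕ) (z : EVec n) (v : ℕ → EVec m) : ℝ :=
  S.J N z v + S.Vf (S.traj z v N)

/-- Optimal value function. -/
def V (N : ℕ) (z : EVec n) : ℝ := sInf (S.objective N z '' S.feasibleInputs N z)

/-- Set of nominal initial states that are feasible over the horizon `N`. -/
def XN (N : ℕ) : Set (EVec n) :=
  {z | ∃ (z' : ℕ → EVec n) (v' : ℕ → EVec m), (∀ t, (z' t, v' t) ∈ S.tight) ∧ z' 0 = z ∧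
    (∀ t < N, z' (t + 1) = S.fPi (z' t) (v' t) 0) ∧ z' N ∈ S.Xf}

/-- `vOpt` and `zOpt` are minimizers of the nominal problem and of the problem in which the
nominal initial state is optimized. -/
def HasMinimizers : Prop :=
  ∀ N : ℕ, 1 ≤ N →
    (∀ z ∈ S.XN N, S.vOpt N z ∈ S.feasibleInputs N z ∧
      ∀ v ∈ S.feasibleInputs N z, S.objective N z (S.vOpt N z) ≤ S.objective N z v) ∧
    (∀ x : EVec n, (∃ z ∈ S.XN N, x - z ∈ S.Ω) →
      S.zOpt N x ∈ S.XN N ∧ x - S.zOpt N x ∈ S.Ω ∧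
        ∀ z ∈ S.XN N, x - z ∈ S.Ω → S.V N (S.zOpt N x) ≤ S.V N z)

/-! ### Closed loop -/

/-- Set of all possible next nominal states. -/
def Zcl (N : ℕ) (z : EVec n) : Set (EVec n) :=
  {y | ∃ e ∈ S.Ω, y = S.zOpt N (S.fPi z (S.vOpt N z 0) 0 + e)}

/-- `z t` is the closed-loop nominal state `z_N(0|t)`. -/
def IsClosedLoop (N : ℕ) (z : ℕ → EVec n) : Prop :=
  z 0 ∈ S.XN N ∧ ∀ t, z (t + 1) ∈ S.Zcl N (z t)

/-- Closed-loop nominal cost over the horizon `T`. -/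
def Jcl (N T : ℕ) (z : ℕ → EVec n) : ℝ :=
  ∑ t ∈ Finset.range T, S.ell (z t, S.vOpt N (z t) 0)

/-- The closed-loop convergence bound, uniform over all prediction horizons. -/
def ConvergenceBound (β : ℝ≥0 → ℝ≥0 → ℝ≥0) : Prop :=
  ∀ N : ℕ, 1 ≤ N → ∀ z : ℕ → EVec n, S.IsClosedLoop N z →
    ∀ t : ℕ, ‖z t - S.zs‖₊ ≤ β ‖z 0 - S.zs‖₊ t

/-! ### Assumptions -/

/-- Constraint and disturbance sets. -/
def ConstraintSets : Prop :=
  IsCompact S.con ∧ Convex ℝ S.con ∧ (interior S.con).Nonempty ∧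
  IsCompact S.dist ∧ Convex ℝ S.dist ∧ (0 : EVec q) ∈ interior S.dist

/-- `Ω` is robust control invariant, and `Ω` and the tightened set have nonempty interior. -/
def RCISet : Prop :=
  S.IsRCI ∧ (interior S.Ω).Nonempty ∧ (interior S.tight).Nonempty

/-- The stage cost arises from a continuous cost `L` and is Lipschitz continuous. -/
def StageCost : Prop :=
  Continuous S.L ∧ S.IsStageCost ∧ ∃ K : ℝ≥0, 0 < K ∧ LipschitzOnWith K S.ell S.costDomain

/-- Terminal region, terminal cost and local auxiliary controller. -/
def Terminal : Prop :=
  IsClosed S.Xf ∧ S.zs ∈ interior S.Xf ∧ ContinuousOn S.Vf S.Xf ∧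
  ∃ κf : EVec n → EVec m, ∀ z ∈ S.Xf, (z, κf z) ∈ S.tight ∧ S.fPi z (κf z) 0 ∈ S.Xf ∧
    S.Vf (S.fPi z (κf z) 0) - S.Vf z ≤ -S.ell (z, κf z) + S.ell (S.zs, S.vs)

/-- `(zs, vs)` minimizes the stage cost over all steady states in the tightened set, and lies
in the interior of that set. -/
def ROSS : Prop :=
  S.zs = S.fPi S.zs S.vs 0 ∧
  (∀ z v, (z, v) ∈ S.tight → z = S.fPi z v 0 → S.ell (S.zs, S.vs) ≤ S.ell (z, v)) ∧
  (S.zs, S.vs) ∈ interior S.tight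

/-- Strict dissipativity of the nominal system with bounded storage function `lam`. -/
def StrictDissipativity (lam : EVec n → ℝ) (αℓ : ℝ≥0 → ℝ≥0) : Prop :=
  IsClassKInf αℓ ∧ (∃ C, ∀ z, |lam z| ≤ C) ∧
  ∀ z v, (z, v) ∈ S.tight →
    lam (S.fPi z v 0) - lam z ≤ S.ell (z, v) - S.ell (S.zs, S.vs) - αℓ (S.ssDist z v)

/-- The dissipation inequality along the closed loop. -/
def ClosedLoopDissipativity (lam : EVec n → ℝ) (αℓ : ℝ≥0 → ℝ≥0) : Prop :=
  ∀ N : ℕ, 1 ≤ N → ∀ z ∈ S.XN N, ∀ y ∈ S.Zcl N z,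
    lam y - lam z ≤ S.ell (z, S.vOpt N z 0) - S.ell (S.zs, S.vs)
      - αℓ (S.ssDist z (S.vOpt N z 0))

/-- Exponential reachability of the steady state from every feasible initial state. -/
def ExponentiallyReachable : Prop :=
  ∀ N : ℕ, 1 ≤ N → ∀ z ∈ S.XN N, ∃ v : ℕ → EVec m, (∀ t, (S.traj z v t, v t) ∈ S.tight) ∧
    ∃ c ρ : ℝ, 0 < c ∧ 0 ≤ ρ ∧ ρ < 1 ∧ ∀ t, (S.ssDist (S.traj z v t) (v t) : ℝ) ≤ c * ρ ^ t

/-- Local `M`-step controllability of the nominal system at `(zs, vs)` for some `M`: points near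
`zs` can be steered to each other in `M` steps along a path that stays near `(zs, vs)`. -/
def LocallyControllable : Prop :=
  ∃ M : ℕ, ∀ ε : ℝ, 0 < ε → ∃ r : ℝ, 0 < r ∧ ∀ y z : EVec n, ‖y - S.zs‖ ≤ r → ‖z - S.zs‖ ≤ r →
    ∃ v : ℕ → EVec m, S.traj y v M = z ∧ ∀ t < M, (S.ssDist (S.traj y v t) (v t) : ℝ) ≤ ε

/-- Continuity of the optimal value functions at the steady state, uniformly in the horizon. -/
def ValueContinuity : Prop :=
  ∃ αV : ℝ≥0 → ℝ≥0, IsClassKInf αV ∧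
    ∀ N : ℕ, 1 ≤ N → ∀ z ∈ S.XN N, |S.V N z - S.V N S.zs| ≤ αV ‖z - S.zs‖₊

end TubeMPC

end

/-!
Along the closed loop the optimal value `V N` decreases by the stage cost relative to the steady
state, because the shifted optimal input prolonged by the terminal controller is feasible. Adding
the storage function `lam` turns this into a strict Lyapunov decrease, and a bounded sequence with
such a decrease obeys a `KL` bound that depends only on the comparison functions involved.

For the transient estimate the decrease is telescoped: the cost over `T` steps is at most
`V N (z 0) - V N (z T)` plus `T` times the steady-state cost. A competing input of bounded excess
cost passes close to the steady state at some early time `P`, so `V N (z 0)` is at most its cost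
up to `P` plus `V (N - P)` near the steady state. The error vanishes since the optimal values at
the steady state, corrected by the cost of staying there, converge as the horizon grows, and since
the part of the competing input after `P` has almost nonnegative excess cost by dissipativity and
the continuity of `lam` at the steady state, a consequence of local controllability.
-/

/-! ### Bounds by comparison functions -/

theorem IsClassK.pos {α : ℝ≥0 → ℝ≥0} (h : IsClassK α) {r : ℝ≥0} (hr : 0 < r) : 0 < α r :=
  h.2.2 ▸ h.2.1 hr

theorem IsClassKInf.add {α γ : ℝ≥0 → ℝ≥0} (hα : IsClassKInf α) (hγ : IsClassKInf γ) :
    IsClassKInf fun r => α r + γ r :=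
  ⟨⟨hα.1.1.add hγ.1.1, hα.1.2.1.add hγ.1.2.1, by simp [hα.1.2.2, hγ.1.2.2]⟩,
    fun b => (hα.2 b).imp fun _ hr => hr.trans_le le_self_add⟩

theorem isClassKInf_id_add {f : ℝ≥0 → ℝ≥0} (hcont : Continuous f) (hmono : Monotone f)
    (h0 : f 0 = 0) : IsClassKInf fun r => r + f r :=
  ⟨⟨continuous_id.add hcont, strictMono_id.add_monotone hmono, by simp [h0]⟩,
    fun b => ⟨b + 1, (lt_add_one b).trans_le le_self_add⟩⟩

theorem IsClassKInf.exists_orderIso {α : ℝ≥0 → ℝ≥0} (h : IsClassKInf α) :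
    ∃ e : ℝ≥0 ≃o ℝ≥0, ⇑e = α := by
  have hsurj : Function.Surjective α := fun c =>
    mem_range_of_exists_le_of_exists_ge h.1.1 ⟨0, by simp [h.1.2.2]⟩
      ((h.2 c).imp fun _ hr => hr.le)
  exact ⟨h.1.2.1.orderIsoOfSurjective α hsurj, rfl⟩

theorem isClassK_orderIso (e : ℝ≥0 ≃o ℝ≥0) : IsClassK e :=
  ⟨e.continuous, e.strictMono, e.map_bot⟩

theorem IsClassK.isClassL_comp_div {α : ℝ≥0 → ℝ≥0} (h : IsClassK α) {c : ℝ≥0} (hc : 0 < c) :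
    IsClassL fun t => α (c / (t + 1)) := by
  have hcont : Continuous fun t : ℝ≥0 => c / (t + 1) :=
    continuous_const.div₀ (by fun_prop) fun t => by positivity
  refine ⟨h.1.comp hcont, fun t t' ht => h.2.1 (by gcongr), ?_⟩
  have hlim : Tendsto (fun t : ℝ≥0 => c / (t + 1)) atTop (𝓝 0) := by
    rw [← NNReal.tendsto_coe]
    push_cast
    exact (tendsto_atTop_add_const_right _ _
      (NNReal.tendsto_coe_atTop.2 tendsto_id)).const_div_atTop (c : ℝ)
  simpa only [h.2.2, Function.comp_def] using (h.1.tendsto 0).comp hlim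

theorem IsClassKL.eventually_mem_of_norm_sub_le {E : Type*} [SeminormedAddCommGroup E]
    {β : ℝ≥0 → ℝ≥0 → ℝ≥0} (hβ : IsClassKL β) (R : ℝ≥0) {c : E} {U : Set E} (hU : U ∈ 𝓝 c) :
    ∀ᶠ T : ℕ in atTop, ∀ r ≤ R, ∀ x, ‖x - c‖₊ ≤ β r T → x ∈ U := by
  obtain ⟨ε, hε, hball⟩ := Metric.mem_nhds_iff.1 hU
  have hlim : Tendsto (fun T : ℕ => (β (R + 1) T : ℝ)) atTop (𝓝 0) :=
    NNReal.tendsto_coe.2 ((hβ.2 (R + 1) (by positivity)).2.2.comp tendsto_natCast_atTop_atTop)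
  filter_upwards [hlim.eventually_lt_const hε] with T hT r hr x hx
  have hβr : β r T ≤ β (R + 1) T := (hβ.1 T).2.1.monotone (hr.trans le_self_add)
  exact hball (mem_ball_iff_norm.2 ((NNReal.coe_le_coe.2 (hx.trans hβr)).trans_lt hT))

theorem continuous_iInf_add_mul {ι : Type*} [Nonempty ι] (b c : ι → ℝ≥0) :
    Continuous fun r => ⨅ i, (b i + c i * r) := by
  have hscale : ∀ s r m : ℝ≥0, m ≤ 1 → m * s ≤ r →
      m * ⨅ i, (b i + c i * s) ≤ ⨅ i, (b i + c i * r) := fun s r m hm hms => by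
    rw [NNReal.mul_iInf]
    refine ciInf_mono (OrderBot.bddBelow _) fun i => ?_
    calc m * (b i + c i * s) = m * b i + c i * (m * s) := by ring
      _ ≤ b i + c i * r := by gcongr; exact mul_le_of_le_one_left' hm
  refine continuous_iff_lower_upperSemicontinuous.2 ⟨fun s y hy => ?_,
    upperSemicontinuous_ciInf (fun _ => OrderBot.bddBelow _)
      fun i => (by fun_prop : Continuous fun r => b i + c i * r).upperSemicontinuous⟩
  rcases eq_or_ne s 0 with rfl | hs
  · exact Eventually.of_forall fun r => hy.trans_le (by simpa using hscale 0 r 1 le_rfl (by simp))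
  · have hcont : ContinuousAt (fun r => min 1 (r / s) * ⨅ i, (b i + c i * s)) s := by fun_prop
    filter_upwards [hcont.eventually_const_lt (by simpa [hs] using hy)] with r hr
    refine hr.trans_le (hscale s r _ (min_le_left _ _) ?_)
    calc min 1 (r / s) * s ≤ r / s * s := by gcongr; exact min_le_right _ _
      _ = r := div_mul_cancel₀ r hs

/-- For each `ε > 0`, `a` lies below the affine function `ε + (B / ρ ε) * s`, where `s x < ρ ε`
forces `a x ≤ ε`; the infimum of these affine functions is the majorant. -/
theorem exists_isClassKInf_majorant {X : Type*} {s : X → ℝ≥0} {a : X → ℝ} {B : ℝ}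
    (hB : ∀ x, a x ≤ B) (h : ∀ ε : ℝ, 0 < ε → ∀ᶠ x in comap s (𝓝 0), a x ≤ ε) :
    ∃ σ : ℝ≥0 → ℝ≥0, IsClassKInf σ ∧ ∀ x, a x ≤ σ (s x) := by
  have hρ : ∀ ε : Set.Ioi (0 : ℝ≥0), ∃ ρ : ℝ≥0, 0 < ρ ∧ ∀ x, s x < ρ → a x ≤ (ε : ℝ≥0) :=
    fun ε => (NNReal.nhds_zero_basis.comap s).eventually_iff.1 (h ε (NNReal.coe_pos.2 ε.2))
  choose ρ hρ_pos hρ_le using hρ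
  let σ : ℝ≥0 → ℝ≥0 := fun r => ⨅ ε : Set.Ioi (0 : ℝ≥0), ((ε : ℝ≥0) + B.toNNReal / ρ ε * r)
  have hσ_mono : Monotone σ := fun r r' hr =>
    ciInf_mono (OrderBot.bddBelow _) fun ε => by gcongr
  have hσ_zero : σ 0 = 0 := nonpos_iff_eq_zero.1 <| le_of_forall_pos_le_add fun ε hε =>
    (ciInf_le (OrderBot.bddBelow _) (⟨ε, hε⟩ : Set.Ioi (0 : ℝ≥0))).trans (by simp)
  have hσ_le : ∀ x, (a x).toNNReal ≤ σ (s x) := fun x => le_ciInf fun ε => by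
    rcases lt_or_ge (s x) (ρ ε) with hx | hx
    · exact (Real.toNNReal_le_iff_le_coe.2 (hρ_le ε x hx)).trans le_self_add
    · calc (a x).toNNReal ≤ B.toNNReal := Real.toNNReal_mono (hB x)
        _ = B.toNNReal / ρ ε * ρ ε := (div_mul_cancel₀ _ (hρ_pos ε).ne').symm
        _ ≤ ε + B.toNNReal / ρ ε * s x := le_add_of_nonneg_of_le zero_le (by gcongr)
  refine ⟨fun r => r + σ r, isClassKInf_id_add (continuous_iInf_add_mul _ _) hσ_mono hσ_zero,
    fun x => Real.toNNReal_le_iff_le_coe.1 ((hσ_le x).trans le_add_self)⟩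

theorem exists_isClassKInf_abs_sub_le {E : Type*} [SeminormedAddCommGroup E] {f : E → ℝ} {c : E}
    {C : ℝ} (hC : ∀ x, |f x| ≤ C) (hf : ContinuousAt f c) :
    ∃ σ : ℝ≥0 → ℝ≥0, IsClassKInf σ ∧ ∀ x, |f x - f c| ≤ σ ‖x - c‖₊ := by
  refine exists_isClassKInf_majorant (s := fun x => ‖x - c‖₊) (a := fun x => |f x - f c|)
    (fun x => (abs_sub (f x) (f c)).trans (add_le_add (hC x) (hC c))) fun ε hε => ?_
  obtain ⟨r, hr, hball⟩ := Metric.eventually_nhds_iff.1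
    (hf.eventually (Metric.closedBall_mem_nhds (f c) hε))
  filter_upwards [preimage_mem_comap (Iio_mem_nhds (Real.toNNReal_pos.2 hr))] with x hx
  refine hball ?_
  rw [dist_eq_norm]
  exact (Real.lt_toNNReal_iff_coe_lt).1 hx

theorem exists_isClassL_majorant {X : Type*} {τ : X → ℕ} {a : X → ℝ} {B : ℝ}
    (hB : ∀ x, a x ≤ B) (h : ∀ ε : ℝ, 0 < ε → ∀ᶠ x in comap τ atTop, a x ≤ ε) :
    ∃ δ : ℝ≥0 → ℝ≥0, IsClassL δ ∧ ∀ x, a x ≤ δ (τ x) := by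
  obtain ⟨σ, hσ, hle⟩ := exists_isClassKInf_majorant (s := fun x => 1 / ((τ x : ℝ≥0) + 1)) hB
    fun ε hε => by
      obtain ⟨K, hK⟩ := eventually_atTop.1 (eventually_comap.1 (h ε hε))
      have hpos : 0 < 1 / ((K : ℝ≥0) + 1) := by positivity
      filter_upwards [preimage_mem_comap (Iio_mem_nhds hpos)] with x hx
      have hlt : (K : ℝ≥0) + 1 < τ x + 1 :=
        (one_div_lt_one_div (by positivity) (by positivity)).1 hx
      exact hK (τ x) (by exact_mod_cast (lt_of_add_lt_add_right hlt).le) x rfl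
  exact ⟨fun t => σ (1 / (t + 1)), hσ.1.isClassL_comp_div one_pos, hle⟩

theorem sum_range_le_sub_of_add_le {a W : ℕ → ℝ} {T : ℕ}
    (h : ∀ t < T, a t + W (t + 1) ≤ W t) : ∑ t ∈ Finset.range T, a t ≤ W 0 - W T :=
  (Finset.sum_le_sum fun t ht => le_sub_iff_add_le.2 (h t (Finset.mem_range.1 ht))).trans_eq
    (Finset.sum_range_sub' W T)

section Decrease

variable {α γ : ℝ≥0 → ℝ≥0} {d : ℕ → ℝ≥0} {W : ℕ → ℝ} {R : ℝ≥0}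

theorem antitone_of_decrease (hdec : ∀ t, α (d t) + W (t + 1) ≤ W t) : Antitone W :=
  antitone_nat_of_succ_le fun t => by linarith [hdec t, (α (d t)).coe_nonneg]

theorem tendsto_zero_of_decrease (hα : IsClassKInf α) {D : ℝ} (hW : ∀ t, |W t| ≤ D)
    (hdec : ∀ t, α (d t) + W (t + 1) ≤ W t) : Tendsto d atTop (𝓝 0) := by
  have hsum : Summable fun t => (α (d t) : ℝ) :=
    summable_of_sum_range_le (c := D + D) (fun _ => NNReal.coe_nonneg _) fun T =>
      calc ∑ t ∈ Finset.range T, (α (d t) : ℝ) ≤ W 0 - W T :=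
          sum_range_le_sub_of_add_le fun t _ => hdec t
        _ ≤ D + D := by linarith [abs_le.1 (hW 0), abs_le.1 (hW T)]
  have hαd : Tendsto (fun t => α (d t)) atTop (𝓝 0) :=
    NNReal.tendsto_coe.1 hsum.tendsto_atTop_zero
  obtain ⟨e, rfl⟩ := hα.exists_orderIso
  have he : e.symm 0 = 0 := e.symm.map_bot
  simpa [Function.comp_def, he] using (e.symm.continuous.tendsto 0).comp hαd

theorem nonneg_of_decrease (hα : IsClassKInf α) (hγ : IsClassK γ) (hR : ∀ t, d t ≤ R)
    (hW : ∀ t, |W t| ≤ γ (d t)) (hdec : ∀ t, α (d t) + W (t + 1) ≤ W t) (t : ℕ) : 0 ≤ W t := by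
  have hWR : ∀ t, |W t| ≤ γ R := fun t =>
    (hW t).trans (NNReal.coe_le_coe.2 (hγ.2.1.monotone (hR t)))
  have hγd : Tendsto (fun t => (γ (d t) : ℝ)) atTop (𝓝 0) :=
    NNReal.tendsto_coe.2 (hγ.2.2 ▸ (hγ.1.tendsto 0).comp (tendsto_zero_of_decrease hα hWR hdec))
  have hWlim : Tendsto W atTop (𝓝 0) := squeeze_zero_norm hW hγd
  exact (antitone_of_decrease hdec).le_of_tendsto hWlim t

/-- Monotonicity gives `α (d t) ≤ W k ≤ γ (d k)` for `k ≤ t`, that is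
`α (γ⁻¹ (α (d t))) ≤ α (d k)`; summing over `k ≤ t` yields a bound of order `1 / (t + 1)`. -/
theorem exists_isClassKL_of_decrease (hα : IsClassKInf α) (hγ : IsClassKInf γ) :
    ∃ β : ℝ≥0 → ℝ≥0 → ℝ≥0, IsClassKL β ∧
      ∀ (d : ℕ → ℝ≥0) (W : ℕ → ℝ) (R : ℝ≥0), (∀ t, d t ≤ R) → (∀ t, |W t| ≤ γ (d t)) →
        (∀ t, α (d t) + W (t + 1) ≤ W t) → ∀ t : ℕ, d t ≤ β (d 0) t := by
  obtain ⟨a, rfl⟩ := hα.exists_orderIso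
  obtain ⟨g, rfl⟩ := hγ.exists_orderIso
  let G : ℝ≥0 ≃o ℝ≥0 := (a.trans g.symm).trans a
  refine ⟨fun r t => G.symm (g r / (t + 1)), ⟨fun t => ⟨?_, ?_, ?_⟩, fun r hr => ?_⟩, ?_⟩
  · exact G.symm.continuous.comp (hγ.1.1.div_const _)
  · intro r r' hr
    have hg : g r < g r' := g.strictMono hr
    exact G.symm.strictMono (by gcongr)
  · simp only [hγ.1.2.2, zero_div]
    exact G.symm.map_bot
  · exact (isClassK_orderIso G.symm).isClassL_comp_div (hγ.1.pos hr)
  · intro d W R hR hW hdec t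
    have hnonneg := nonneg_of_decrease hα hγ.1 hR hW hdec
    have hWg : ∀ k, W k ≤ g (d k) := fun k => (le_abs_self _).trans (hW k)
    have hG : ∀ k ≤ t, G (d t) ≤ a (d k) := fun k hk => by
      refine a.monotone ((OrderIso.symm_apply_le g).2 (NNReal.coe_le_coe.1 ?_))
      calc (a (d t) : ℝ) ≤ W t := by linarith [hdec t, hnonneg (t + 1)]
        _ ≤ W k := antitone_of_decrease hdec hk
        _ ≤ g (d k) := hWg k
    rw [OrderIso.le_symm_apply, le_div_iff₀ (by positivity), ← NNReal.coe_le_coe]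
    calc ((G (d t) * (t + 1) : ℝ≥0) : ℝ) = ∑ _k ∈ Finset.range (t + 1), (G (d t) : ℝ) := by
          simp [mul_comm]
      _ ≤ ∑ k ∈ Finset.range (t + 1), (a (d k) : ℝ) := Finset.sum_le_sum fun k hk =>
          NNReal.coe_le_coe.2 (hG k (Nat.lt_succ_iff.1 (Finset.mem_range.1 hk)))
      _ ≤ W 0 - W (t + 1) := sum_range_le_sub_of_add_le fun k _ => hdec k
      _ ≤ g (d 0) := by linarith [hnonneg (t + 1), hWg 0]

end Decrease


/-! ### Trajectories and concatenation of inputs -/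

/-- The sequence that follows `v` for `P` steps and then starts `w` from its beginning; it is used
to patch input sequences together along a trajectory. -/
def concatSeq {X : Type*} (P : ℕ) (v w : ℕ → X) (t : ℕ) : X :=
  if t < P then v t else w (t - P)

theorem concatSeq_of_lt {X : Type*} {P t : ℕ} (v w : ℕ → X) (h : t < P) :
    concatSeq P v w t = v t := if_pos h

theorem concatSeq_add {X : Type*} (P t : ℕ) (v w : ℕ → X) :
    concatSeq P v w (P + t) = w t := by simp [concatSeq]

namespace TubeMPC

variable {n m q : ℕ} {S : TubeMPC n m q}

section Trajectories

variable {P K T N t : ℕ} {z : EVec n} {v w : ℕ → EVec m}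

theorem traj_congr (h : ∀ s < t, v s = w s) : S.traj z v t = S.traj z w t := by
  induction t with
  | zero => rfl
  | succ t ih => simp only [traj, ih fun s hs => h s (by omega), h t (by omega)]

theorem traj_add (P t : ℕ) :
    S.traj z v (P + t) = S.traj (S.traj z v P) (fun s => v (P + s)) t := by
  induction t with
  | zero => rfl
  | succ t ih => rw [← add_assoc]; simp only [traj, ih]

theorem traj_concatSeq (h : t ≤ P) : S.traj z (concatSeq P v w) t = S.traj z v t :=
  traj_congr fun _ hs => concatSeq_of_lt v w (by omega)

theorem traj_concatSeq_add (P t : ℕ) :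
    S.traj z (concatSeq P v w) (P + t) = S.traj (S.traj z v P) w t := by
  rw [traj_add, traj_concatSeq le_rfl]
  simp only [concatSeq_add]

theorem J_add (P K : ℕ) :
    S.J (P + K) z v = S.J P z v + S.J K (S.traj z v P) (fun s => v (P + s)) := by
  simp only [J, Finset.sum_range_add, traj_add]

theorem J_concatSeq (P : ℕ) : S.J P z (concatSeq P v w) = S.J P z v :=
  Finset.sum_congr rfl fun t ht => by
    have ht := Finset.mem_range.1 ht
    rw [traj_concatSeq ht.le, concatSeq_of_lt _ _ ht]

theorem admissible_mono (h : P ≤ T) (hv : v ∈ S.admissible T z) : v ∈ S.admissible P z :=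
  fun t ht => hv t (ht.trans_le h)

theorem admissible_shift (hv : v ∈ S.admissible (P + K) z) :
    (fun s => v (P + s)) ∈ S.admissible K (S.traj z v P) := fun t ht => by
  rw [← traj_add]
  exact hv (P + t) (by omega)

theorem feasibleInputs_shift (hv : v ∈ S.feasibleInputs (P + K) z) :
    (fun s => v (P + s)) ∈ S.feasibleInputs K (S.traj z v P) :=
  ⟨admissible_shift hv.1, by rw [← traj_add]; exact hv.2⟩

theorem concatSeq_mem_feasibleInputs (hv : v ∈ S.admissible P z)
    (hw : w ∈ S.feasibleInputs K (S.traj z v P)) :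
    concatSeq P v w ∈ S.feasibleInputs (P + K) z := by
  refine ⟨fun t ht => ?_, by rw [traj_concatSeq_add]; exact hw.2⟩
  rcases lt_or_ge t P with h | h
  · rw [traj_concatSeq h.le, concatSeq_of_lt _ _ h]
    exact hv t h
  · obtain ⟨s, rfl⟩ := Nat.exists_eq_add_of_le h
    rw [traj_concatSeq_add, concatSeq_add]
    exact hw.1 s (by omega)

theorem objective_concatSeq (P K : ℕ) :
    S.objective (P + K) z (concatSeq P v w) =
      S.J P z v + S.objective K (S.traj z v P) w := by
  simp only [objective, J_add, J_concatSeq, traj_concatSeq le_rfl, concatSeq_add,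
    traj_concatSeq_add, add_assoc]

theorem objective_add (P K : ℕ) :
    S.objective (P + K) z v =
      S.J P z v + S.objective K (S.traj z v P) (fun s => v (P + s)) := by
  simp only [objective, J_add, ← traj_add, add_assoc]

end Trajectories

/-! ### Feasibility and dynamic programming -/

section DynamicProgramming

variable {P K N : ℕ} {z : EVec n} {v : ℕ → EVec m}

theorem XN_subset_fst_image_tight (N : ℕ) : S.XN N ⊆ Prod.fst '' S.tight := by
  rintro _ ⟨z', v', htight, rfl, -⟩
  exact ⟨_, htight 0, rfl⟩

/-- Membership in `XN` asks for constraint satisfaction at all times, which the terminal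
controller provides beyond the horizon. -/
theorem mem_XN_iff (hterm : S.Terminal) : z ∈ S.XN N ↔ (S.feasibleInputs N z).Nonempty := by
  obtain ⟨-, -, -, κf, hκ⟩ := hterm
  constructor
  · rintro ⟨z', v', htight, h0, hstep, hN⟩
    have htraj : ∀ t ≤ N, S.traj z v' t = z' t := fun t => by
      induction t with
      | zero => exact fun _ => h0.symm
      | succ t ih => intro h; rw [hstep t (by omega), traj, ih (by omega)]
    refine ⟨v', fun t h => ?_, ?_⟩
    · rw [htraj t h.le]
      exact htight t
    · rwa [htraj N le_rfl]
  · rintro ⟨v, hv, hN⟩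
    refine ⟨fun t => S.traj z v (min t N),
      fun t => if t < N then v t else κf (S.traj z v N), fun t => ?_, by simp [traj],
      fun t ht => ?_, by simpa using hN⟩
    · rcases lt_or_ge t N with h | h
      · simpa [h, h.le] using hv t h
      · simpa [h, not_lt.2 h] using (hκ _ hN).1
    · simp [ht, ht.le, traj]

theorem exists_feasibleInputs_succ (hterm : S.Terminal) (hv : v ∈ S.feasibleInputs K z) :
    ∃ w ∈ S.feasibleInputs (K + 1) z,
      S.objective (K + 1) z w ≤ S.objective K z v + S.ell (S.zs, S.vs) := by
  obtain ⟨-, -, -, κf, hκ⟩ := hterm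
  obtain ⟨hκ_tight, hκ_Xf, hκ_cost⟩ := hκ _ hv.2
  refine ⟨concatSeq K v fun _ => κf (S.traj z v K), concatSeq_mem_feasibleInputs hv.1
    ⟨fun t ht => ?_, hκ_Xf⟩, ?_⟩
  · obtain rfl : t = 0 := by omega
    exact hκ_tight
  · rw [objective_concatSeq]
    simp only [objective, J, Finset.sum_range_one, traj]
    linarith

theorem Xf_subset_XN (hterm : S.Terminal) (N : ℕ) : S.Xf ⊆ S.XN N := fun z hz => by
  rw [mem_XN_iff hterm]
  induction N with
  | zero => exact ⟨fun _ => 0, fun t ht => absurd ht (Nat.not_lt_zero t), hz⟩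
  | succ N ih =>
    obtain ⟨v, hv⟩ := ih
    obtain ⟨w, hw, -⟩ := exists_feasibleInputs_succ hterm hv
    exact ⟨w, hw⟩

theorem zs_mem_XN (hterm : S.Terminal) (N : ℕ) : S.zs ∈ S.XN N :=
  Xf_subset_XN hterm N (interior_subset hterm.2.1)

theorem V_eq (hmin : S.HasMinimizers) (hN : 1 ≤ N) (hz : z ∈ S.XN N) :
    S.V N z = S.objective N z (S.vOpt N z) := by
  obtain ⟨hfeas, hopt⟩ := (hmin N hN).1 z hz
  exact IsLeast.csInf_eq ⟨⟨_, hfeas, rfl⟩, by rintro _ ⟨v, hv, rfl⟩; exact hopt v hv⟩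

theorem V_le (hmin : S.HasMinimizers) (hterm : S.Terminal) (hN : 1 ≤ N)
    (hv : v ∈ S.feasibleInputs N z) : S.V N z ≤ S.objective N z v := by
  have hz := (mem_XN_iff hterm).2 ⟨v, hv⟩
  rw [V_eq hmin hN hz]
  exact ((hmin N hN).1 z hz).2 v hv

theorem V_add_le (hmin : S.HasMinimizers) (hterm : S.Terminal) (hK : 1 ≤ K)
    (hv : v ∈ S.admissible P z) (hz : S.traj z v P ∈ S.XN K) :
    S.V (P + K) z ≤ S.J P z v + S.V K (S.traj z v P) := by
  rw [V_eq hmin hK hz, ← objective_concatSeq]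
  exact V_le hmin hterm (by omega)
    (concatSeq_mem_feasibleInputs hv ((hmin K hK).1 _ hz).1)

theorem V_succ_le (hmin : S.HasMinimizers) (hterm : S.Terminal) (hK : 1 ≤ K)
    (hz : z ∈ S.XN K) : S.V (K + 1) z ≤ S.V K z + S.ell (S.zs, S.vs) := by
  obtain ⟨w, hw, hle⟩ := exists_feasibleInputs_succ hterm ((hmin K hK).1 z hz).1
  rw [V_eq hmin hK hz]
  exact (V_le hmin hterm (by omega) hw).trans hle

end DynamicProgramming

section ClosedLoop

variable {N : ℕ} {z : ℕ → EVec n}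

/-- The shifted optimal sequence, prolonged by the terminal controller, is feasible at the nominal
successor state, which in turn is a candidate in the problem that `y` solves. -/
theorem mem_XN_and_V_le_of_mem_Zcl (hmin : S.HasMinimizers) (hterm : S.Terminal) (hN : 1 ≤ N)
    {x y : EVec n} (hx : x ∈ S.XN N) (hy : y ∈ S.Zcl N x) :
    y ∈ S.XN N ∧ S.V N y ≤ S.V N x - S.ell (x, S.vOpt N x 0) + S.ell (S.zs, S.vs) := by
  obtain ⟨K, rfl⟩ := Nat.exists_eq_add_of_le hN
  have hopt := ((hmin _ hN).1 x hx).1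
  obtain ⟨w, hw, hle⟩ := exists_feasibleInputs_succ hterm (feasibleInputs_shift hopt)
  rw [add_comm K 1] at hw hle
  have hnext := (mem_XN_iff hterm).2 ⟨w, hw⟩
  obtain ⟨e, he, rfl⟩ := hy
  have hΩ : S.fPi x (S.vOpt (1 + K) x 0) 0 + e - S.traj x (S.vOpt (1 + K) x) 1 ∈ S.Ω := by
    simpa [traj] using he
  obtain ⟨hy, -, hy_le⟩ := (hmin _ hN).2 _ ⟨_, hnext, hΩ⟩
  refine ⟨hy, (hy_le _ hnext hΩ).trans ((V_le hmin hterm hN hw).trans (hle.trans ?_))⟩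
  rw [V_eq hmin hN hx, objective_add]
  simp [J, traj]

theorem IsClosedLoop.mem_XN (hmin : S.HasMinimizers) (hterm : S.Terminal) (hN : 1 ≤ N)
    (hz : S.IsClosedLoop N z) (t : ℕ) : z t ∈ S.XN N := by
  induction t with
  | zero => exact hz.1
  | succ t ih => exact (mem_XN_and_V_le_of_mem_Zcl hmin hterm hN ih (hz.2 t)).1

theorem IsClosedLoop.V_succ_le (hmin : S.HasMinimizers) (hterm : S.Terminal) (hN : 1 ≤ N)
    (hz : S.IsClosedLoop N z) (t : ℕ) :
    S.V N (z (t + 1)) ≤ S.V N (z t) - S.ell (z t, S.vOpt N (z t) 0) + S.ell (S.zs, S.vs) :=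
  (mem_XN_and_V_le_of_mem_Zcl hmin hterm hN (hz.mem_XN hmin hterm hN t) (hz.2 t)).2

theorem IsClosedLoop.Jcl_le (hmin : S.HasMinimizers) (hterm : S.Terminal) (hN : 1 ≤ N)
    (hz : S.IsClosedLoop N z) (T : ℕ) :
    S.Jcl N T z ≤ S.V N (z 0) - S.V N (z T) + T * S.ell (S.zs, S.vs) := by
  have hsum := sum_range_le_sub_of_add_le (T := T) (W := fun t => S.V N (z t))
    (a := fun t => S.ell (z t, S.vOpt N (z t) 0) - S.ell (S.zs, S.vs))
    fun t _ => by linarith [hz.V_succ_le hmin hterm hN t]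
  rw [Finset.sum_sub_distrib, Finset.sum_const, Finset.card_range, nsmul_eq_mul] at hsum
  exact sub_le_iff_le_add.1 hsum

end ClosedLoop

theorem isBounded_fst_image_tight (hcon : Bornology.IsBounded S.con) (hΩ : S.Ω.Nonempty) :
    Bornology.IsBounded (Prod.fst '' S.tight) := by
  obtain ⟨e, he⟩ := hΩ
  refine ((hcon.image_fst).sub (Bornology.isBounded_singleton (x := e))).subset ?_
  rintro _ ⟨p, hp, rfl⟩
  exact ⟨p.1 + e, ⟨_, hp e he, rfl⟩, e, rfl, add_sub_cancel_right _ _⟩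

theorem exists_nnnorm_sub_zs_le (hbdd : Bornology.IsBounded (Prod.fst '' S.tight)) :
    ∃ R : ℝ≥0, ∀ N, ∀ z ∈ S.XN N, ‖z - S.zs‖₊ ≤ R := by
  obtain ⟨R, hR⟩ := hbdd.subset_closedBall S.zs
  refine ⟨R.toNNReal, fun N z hz => ?_⟩
  exact NNReal.le_toNNReal_of_coe_le
    (mem_closedBall_iff_norm.1 (hR (XN_subset_fst_image_tight N hz)))

theorem bddBelow_image_Vf (hterm : S.Terminal)
    (hbdd : Bornology.IsBounded (Prod.fst '' S.tight)) : BddBelow (S.Vf '' S.Xf) := by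
  obtain ⟨hclosed, -, hcont, κf, hκ⟩ := hterm
  have hXf : S.Xf ⊆ Prod.fst '' S.tight := fun z hz => ⟨_, (hκ z hz).1, rfl⟩
  exact (Metric.isCompact_of_isClosed_isBounded hclosed (hbdd.subset hXf)).bddBelow_image hcont

theorem nnnorm_sub_le_ssDist (z : EVec n) (v : EVec m) : ‖z - S.zs‖₊ ≤ S.ssDist z v :=
  WithLp.nnnorm_fst_le _ (WithLp.toLp 2 (z - S.zs, v - S.vs))

theorem dist_le_ssDist (z : EVec n) (v : EVec m) :
    Dist.dist (z, v) (S.zs, S.vs) ≤ S.ssDist z v := by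
  rw [Prod.dist_eq, dist_eq_norm, dist_eq_norm]
  exact max_le (nnnorm_sub_le_ssDist z v)
    (WithLp.norm_snd_le _ (WithLp.toLp 2 (z - S.zs, v - S.vs)))

theorem StageCost.continuousAt_ell (hcost : S.StageCost) {p : EVec n × EVec m}
    (hp : S.tight ∈ 𝓝 p) : ContinuousAt S.ell p := by
  obtain ⟨-, -, _, -, hLip⟩ := hcost
  exact hLip.continuousOn.continuousAt (mem_of_superset hp Set.subset_union_right)

/-! ### Strict dissipativity -/

section Dissipativity

variable {lam : EVec n → ℝ} {αℓ : ℝ≥0 → ℝ≥0} {T : ℕ} {z : EVec n} {v : ℕ → EVec m}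

theorem sum_le_of_dissipativity (hdiss : S.StrictDissipativity lam αℓ)
    (hv : v ∈ S.admissible T z) :
    ∑ t ∈ Finset.range T, (αℓ (S.ssDist (S.traj z v t) (v t)) : ℝ) ≤
      S.J T z v - T * S.ell (S.zs, S.vs) + lam z - lam (S.traj z v T) := by
  have hsum := sum_range_le_sub_of_add_le (T := T) (W := fun t => lam (S.traj z v t))
    (a := fun t => αℓ (S.ssDist (S.traj z v t) (v t)) -
      (S.ell (S.traj z v t, v t) - S.ell (S.zs, S.vs)))
    fun t ht => by
      have := hdiss.2.2 _ _ (hv t ht)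
      simp only [traj]
      linarith
  simp only [Finset.sum_sub_distrib, Finset.sum_const, Finset.card_range, nsmul_eq_mul,
    traj] at hsum
  rw [J]
  linarith

theorem lam_sub_le (hdiss : S.StrictDissipativity lam αℓ) (hv : v ∈ S.admissible T z) :
    lam (S.traj z v T) - lam z ≤ S.J T z v - T * S.ell (S.zs, S.vs) := by
  have hnonneg : 0 ≤ ∑ t ∈ Finset.range T, (αℓ (S.ssDist (S.traj z v t) (v t)) : ℝ) :=
    Finset.sum_nonneg fun _ _ => NNReal.coe_nonneg _
  linarith [sum_le_of_dissipativity hdiss hv]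

theorem LocallyControllable.exists_path_mem (hctrl : S.LocallyControllable) :
    ∃ M : ℕ, ∀ U ∈ 𝓝 (S.zs, S.vs), ∃ r : ℝ, 0 < r ∧ ∀ y z : EVec n,
      ‖y - S.zs‖ ≤ r → ‖z - S.zs‖ ≤ r →
        ∃ v : ℕ → EVec m, S.traj y v M = z ∧ ∀ t < M, (S.traj y v t, v t) ∈ U := by
  obtain ⟨M, hM⟩ := hctrl
  refine ⟨M, fun U hU => ?_⟩
  obtain ⟨ε, hε, hball⟩ := Metric.nhds_basis_closedBall.mem_iff.1 hU
  obtain ⟨r, hr, hpath⟩ := hM ε hε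
  refine ⟨r, hr, fun y z hy hz => ?_⟩
  obtain ⟨v, hv, hclose⟩ := hpath y z hy hz
  exact ⟨v, hv, fun t ht => hball ((dist_le_ssDist _ _).trans (hclose t ht))⟩

/-- The dissipation inequality along a path that joins two points near `zs` while staying near
`(zs, vs)` bounds the increase of the storage function, and by symmetry its variation. -/
theorem continuousAt_lam (hcost : ContinuousAt S.ell (S.zs, S.vs))
    (htight : S.tight ∈ 𝓝 (S.zs, S.vs)) (hdiss : S.StrictDissipativity lam αℓ)
    (hctrl : S.LocallyControllable) : ContinuousAt lam S.zs := by
  obtain ⟨M, hM⟩ := hctrl.exists_path_mem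
  refine Metric.continuousAt_iff'.2 fun ε hε => ?_
  have hη : S.ell (S.zs, S.vs) < S.ell (S.zs, S.vs) + ε / (M + 1) :=
    lt_add_of_pos_right _ (by positivity)
  obtain ⟨r, hr, hpath⟩ := hM _ (inter_mem htight (hcost.eventually_lt_const hη))
  have hlam : ∀ y z, ‖y - S.zs‖ ≤ r → ‖z - S.zs‖ ≤ r → lam z - lam y < ε := by
    intro y z hy hz
    obtain ⟨v, rfl, hv⟩ := hpath y z hy hz
    calc lam (S.traj y v M) - lam y ≤ S.J M y v - M * S.ell (S.zs, S.vs) :=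
          lam_sub_le hdiss fun t ht => (hv t ht).1
      _ = ∑ t ∈ Finset.range M, (S.ell (S.traj y v t, v t) - S.ell (S.zs, S.vs)) := by
          simp [J]
      _ ≤ ∑ _t ∈ Finset.range M, ε / (M + 1) := Finset.sum_le_sum fun t ht =>
          sub_le_iff_le_add'.2 (hv t (Finset.mem_range.1 ht)).2.le
      _ = M / (M + 1) * ε := by simp only [Finset.sum_const, Finset.card_range, nsmul_eq_mul]; ring
      _ < ε := mul_lt_of_lt_one_left hε ((div_lt_one (by positivity)).2 (lt_add_one _))
  have hzs : ‖S.zs - S.zs‖ ≤ r := by simpa using hr.le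
  filter_upwards [Metric.closedBall_mem_nhds S.zs hr] with z hz
  have hz := mem_closedBall_iff_norm.1 hz
  exact abs_sub_lt_iff.2 ⟨hlam _ _ hzs hz, hlam _ _ hz hzs⟩

end Dissipativity

theorem exists_convergenceBound (hmin : S.HasMinimizers) (hterm : S.Terminal)
    (hbdd : Bornology.IsBounded (Prod.fst '' S.tight)) {lam : EVec n → ℝ} {αℓ : ℝ≥0 → ℝ≥0}
    (hdiss : S.StrictDissipativity lam αℓ) (hcldiss : S.ClosedLoopDissipativity lam αℓ)
    (hlam : ContinuousAt lam S.zs) (hval : S.ValueContinuity) :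
    ∃ β : ℝ≥0 → ℝ≥0 → ℝ≥0, IsClassKL β ∧ S.ConvergenceBound β := by
  obtain ⟨αV, hαV, hV⟩ := hval
  obtain ⟨C, hC⟩ := hdiss.2.1
  obtain ⟨σ, hσ, hlamσ⟩ := exists_isClassKInf_abs_sub_le hC hlam
  obtain ⟨R, hR⟩ := exists_nnnorm_sub_zs_le hbdd
  obtain ⟨β, hβ, hbound⟩ := exists_isClassKL_of_decrease hdiss.1 (hαV.add hσ)
  refine ⟨β, hβ, fun N hN z hz => ?_⟩
  have hX := hz.mem_XN hmin hterm hN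
  refine hbound _ (fun t => (S.V N (z t) - S.V N S.zs) + (lam (z t) - lam S.zs)) R
    (fun t => hR N _ (hX t)) (fun t => ?_) fun t => ?_
  · push_cast
    exact (abs_add_le _ _).trans (add_le_add (hV N hN _ (hX t)) (hlamσ _))
  · have hVdec := hz.V_succ_le hmin hterm hN t
    have hlamdec := hcldiss N hN _ (hX t) _ (hz.2 t)
    have hdist : (αℓ ‖z t - S.zs‖₊ : ℝ) ≤ αℓ (S.ssDist (z t) (S.vOpt N (z t) 0)) :=
      hdiss.1.1.2.1.monotone (nnnorm_sub_le_ssDist _ _)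
    linarith

/-! ### Optimal values near the steady state -/

theorem ValueContinuity.exists_abs_sub_le (hval : S.ValueContinuity)
    (hbdd : Bornology.IsBounded (Prod.fst '' S.tight)) :
    ∃ D : ℝ, ∀ N : ℕ, 1 ≤ N → ∀ z ∈ S.XN N, |S.V N z - S.V N S.zs| ≤ D := by
  obtain ⟨αV, hαV, hV⟩ := hval
  obtain ⟨R, hR⟩ := exists_nnnorm_sub_zs_le hbdd
  exact ⟨αV R, fun N hN z hz =>
    (hV N hN z hz).trans (NNReal.coe_le_coe.2 (hαV.1.2.1.monotone (hR N z hz)))⟩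

theorem ValueContinuity.eventually_abs_sub_le (hval : S.ValueContinuity) {ε : ℝ} (hε : 0 < ε) :
    ∀ᶠ z in 𝓝 S.zs, ∀ N : ℕ, 1 ≤ N → z ∈ S.XN N → |S.V N z - S.V N S.zs| ≤ ε := by
  obtain ⟨αV, hαV, hV⟩ := hval
  have hcont : Continuous fun z => (αV ‖z - S.zs‖₊ : ℝ) :=
    NNReal.continuous_coe.comp (hαV.1.1.comp (by fun_prop))
  have hzero : (αV ‖S.zs - S.zs‖₊ : ℝ) < ε := by simpa [hαV.1.2.2] using hε
  filter_upwards [hcont.continuousAt.eventually_lt_const hzero] with z hz N hN hzN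
  exact (hV N hN z hzN).trans hz.le

variable (S) in
/-- The optimal value over the horizon `N` in excess of the cost of staying at the steady state
for `N` steps; unlike `V N z`, it remains bounded as `N` grows. -/
noncomputable def excessValue (N : ℕ) (z : EVec n) : ℝ := S.V N z - N * S.ell (S.zs, S.vs)

theorem excessValue_succ_le (hmin : S.HasMinimizers) (hterm : S.Terminal) {N : ℕ} (hN : 1 ≤ N)
    {z : EVec n} (hz : z ∈ S.XN N) : S.excessValue (N + 1) z ≤ S.excessValue N z := by
  have := V_succ_le hmin hterm hN hz
  simp only [excessValue]
  push_cast
  linarith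

theorem exists_le_excessValue (hmin : S.HasMinimizers) (hterm : S.Terminal)
    (hbdd : Bornology.IsBounded (Prod.fst '' S.tight)) {lam : EVec n → ℝ} {αℓ : ℝ≥0 → ℝ≥0}
    (hdiss : S.StrictDissipativity lam αℓ) :
    ∃ b : ℝ, ∀ N : ℕ, 1 ≤ N → ∀ z ∈ S.XN N, b ≤ S.excessValue N z := by
  obtain ⟨D, hD⟩ := bddBelow_image_Vf hterm hbdd
  obtain ⟨C, hC⟩ := hdiss.2.1
  refine ⟨D - 2 * C, fun N hN z hz => ?_⟩
  obtain ⟨hadm, hXf⟩ := ((hmin N hN).1 z hz).1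
  have hVf := hD ⟨_, hXf, rfl⟩
  have hlam := lam_sub_le hdiss hadm
  rw [excessValue, V_eq hmin hN hz, objective]
  linarith [(abs_le.1 (hC z)).2, (abs_le.1 (hC (S.traj z (S.vOpt N z) N))).1]

theorem exists_tendsto_excessValue (hmin : S.HasMinimizers) (hterm : S.Terminal)
    (hbdd : Bornology.IsBounded (Prod.fst '' S.tight)) {lam : EVec n → ℝ} {αℓ : ℝ≥0 → ℝ≥0}
    (hdiss : S.StrictDissipativity lam αℓ) {z : EVec n} (hz : ∀ N, z ∈ S.XN N) :
    ∃ w, Tendsto (fun N => S.excessValue N z) atTop (𝓝 w) := by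
  obtain ⟨b, hb⟩ := exists_le_excessValue hmin hterm hbdd hdiss
  have hanti : Antitone fun N => S.excessValue (N + 1) z := antitone_nat_of_succ_le fun N =>
    excessValue_succ_le hmin hterm N.succ_pos (hz _)
  have hbelow : BddBelow (Set.range fun N => S.excessValue (N + 1) z) :=
    ⟨b, by rintro _ ⟨N, rfl⟩; exact hb _ N.succ_pos z (hz _)⟩
  exact ⟨_, (tendsto_add_atTop_iff_nat 1).1 (tendsto_atTop_ciInf hanti hbelow)⟩

/-! ### Transient performance -/

section TransientPerformance

variable {lam : EVec n → ℝ} {αℓ : ℝ≥0 → ℝ≥0}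

/-- Compared with the input that follows `v` up to time `P` and is optimal afterwards, the closed
loop saves what `v` still pays after time `P`, which dissipativity bounds from below. -/
theorem IsClosedLoop.Jcl_sub_J_le (hmin : S.HasMinimizers) (hterm : S.Terminal)
    (hdiss : S.StrictDissipativity lam αℓ) {P K L : ℕ} (hK : 1 ≤ K) {z : ℕ → EVec n}
    {v : ℕ → EVec m} (hz : S.IsClosedLoop (P + K) z) (hv : v ∈ S.admissible (P + L) (z 0))
    (hP : S.traj (z 0) v P ∈ S.XN K) :
    S.Jcl (P + K) (P + L) z - S.J (P + L) (z 0) v ≤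
      S.excessValue K (S.traj (z 0) v P) - S.excessValue (P + K) (z (P + L)) +
        (lam (S.traj (z 0) v P) - lam (S.traj (z 0) v (P + L))) := by
  have hJcl := hz.Jcl_le hmin hterm (by omega) (P + L)
  have hV := V_add_le hmin hterm hK (admissible_mono (P.le_add_right L) hv) hP
  have hlam := lam_sub_le hdiss (admissible_shift hv)
  rw [← traj_add] at hlam
  rw [J_add]
  simp only [excessValue]
  push_cast at hJcl ⊢
  linarith

/-- The turnpike property: every step spent outside `U` adds a fixed amount to the excess cost. -/
theorem exists_lt_traj_mem (hdiss : S.StrictDissipativity lam αℓ) {U : Set (EVec n)}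
    (hU : U ∈ 𝓝 S.zs) (B : ℝ) :
    ∃ K : ℕ, ∀ T ≥ K, ∀ z, ∀ v ∈ S.admissible T z,
      S.J T z v - T * S.ell (S.zs, S.vs) ≤ B → ∃ P < K, S.traj z v P ∈ U := by
  obtain ⟨ε, hε, hball⟩ := Metric.mem_nhds_iff.1 hU
  lift ε to ℝ≥0 using hε.le
  obtain ⟨C, hC⟩ := hdiss.2.1
  have hη : (0 : ℝ) < αℓ ε := hdiss.1.1.pos (NNReal.coe_pos.1 hε)
  obtain ⟨K, hK⟩ := exists_nat_gt ((B + 2 * C) / αℓ ε)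
  rw [div_lt_iff₀ hη] at hK
  refine ⟨K, fun T hT z v hv hJ => ?_⟩
  have hsum : ∑ t ∈ Finset.range K, (αℓ (S.ssDist (S.traj z v t) (v t)) : ℝ) <
      ∑ _t ∈ Finset.range K, (αℓ ε : ℝ) := by
    calc _ ≤ ∑ t ∈ Finset.range T, (αℓ (S.ssDist (S.traj z v t) (v t)) : ℝ) :=
          Finset.sum_le_sum_of_subset_of_nonneg (Finset.range_mono hT)
            fun _ _ _ => NNReal.coe_nonneg _
      _ ≤ S.J T z v - T * S.ell (S.zs, S.vs) + lam z - lam (S.traj z v T) :=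
          sum_le_of_dissipativity hdiss hv
      _ ≤ B + 2 * C := by
          linarith [(abs_le.1 (hC z)).2, (abs_le.1 (hC (S.traj z v T))).1]
      _ < ∑ _t ∈ Finset.range K, (αℓ ε : ℝ) := by simpa using hK
  obtain ⟨P, hP, hlt⟩ := Finset.exists_lt_of_sum_lt hsum
  have hdist : S.ssDist (S.traj z v P) (v P) < ε :=
    hdiss.1.1.2.1.lt_iff_lt.1 (NNReal.coe_lt_coe.1 hlt)
  exact ⟨P, Finset.mem_range.1 hP,
    hball (mem_ball_iff_norm.2 ((nnnorm_sub_le_ssDist _ (v P)).trans_lt hdist))⟩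

variable (S) in
/-- The terminal states at which the storage function and all optimal value functions are
`ε`-close to their values at the steady state; the turnpike argument takes place there. -/
def nearSteadyState (lam : EVec n → ℝ) (ε : ℝ) : Set (EVec n) :=
  {y ∈ S.Xf | |lam y - lam S.zs| ≤ ε ∧ ∀ N : ℕ, 1 ≤ N → |S.V N y - S.V N S.zs| ≤ ε}

theorem nearSteadyState_mem_nhds (hterm : S.Terminal) (hlam : ContinuousAt lam S.zs)
    (hval : S.ValueContinuity) {ε : ℝ} (hε : 0 < ε) : S.nearSteadyState lam ε ∈ 𝓝 S.zs := by
  filter_upwards [mem_interior_iff_mem_nhds.1 hterm.2.1,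
    hlam.eventually (Metric.closedBall_mem_nhds _ hε), hval.eventually_abs_sub_le hε]
    with y hXf hlamy hV
  exact ⟨hXf, hlamy, fun N hN => hV N hN (Xf_subset_XN hterm N hXf)⟩

theorem IsClosedLoop.Jcl_sub_J_le_of_mem_nearSteadyState (hmin : S.HasMinimizers)
    (hterm : S.Terminal) (hdiss : S.StrictDissipativity lam αℓ) {P N T : ℕ} (hPN : P < N)
    (hPT : P ≤ T) {z : ℕ → EVec n} {v : ℕ → EVec m} (hz : S.IsClosedLoop N z)
    (hv : v ∈ S.admissible T (z 0)) {ε : ℝ} (hP : S.traj (z 0) v P ∈ S.nearSteadyState lam ε)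
    (hT : S.traj (z 0) v T ∈ S.nearSteadyState lam ε) (hzT : z T ∈ S.nearSteadyState lam ε) :
    S.Jcl N T z - S.J T (z 0) v ≤
      S.excessValue (N - P) S.zs - S.excessValue N S.zs + 4 * ε := by
  obtain ⟨K, rfl⟩ := Nat.exists_eq_add_of_le hPN.le
  obtain ⟨L, rfl⟩ := Nat.exists_eq_add_of_le hPT
  have hK : 1 ≤ K := by omega
  have hgap := hz.Jcl_sub_J_le hmin hterm hdiss hK hv (Xf_subset_XN hterm K hP.1)
  simp only [excessValue, Nat.add_sub_cancel_left] at hgap ⊢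
  linarith [(abs_le.1 (hP.2.2 K hK)).2, (abs_le.1 (hzT.2.2 (P + K) (by omega))).1,
    (abs_le.1 hP.2.1).2, (abs_le.1 hT.2.1).1]

/-- A closed-loop sequence `z` for the prediction horizon `N`, together with a competing open-loop
input `v` over the performance horizon `T`. Majorants of the performance gap are taken over this
type, which makes them uniform in the horizons and in the initial state. -/
structure TransientComparison (S : TubeMPC n m q) (β : ℝ≥0 → ℝ≥0 → ℝ≥0) where
  N : ℕ
  T : ℕ
  z : ℕ → EVec n
  v : ℕ → EVec m
  one_le : 1 ≤ N
  isClosedLoop : S.IsClosedLoop N z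
  mem_admissibleToBall : v ∈ S.admissibleToBall (β ‖z 0 - S.zs‖₊ T) T (z 0)

namespace TransientComparison

variable {β : ℝ≥0 → ℝ≥0 → ℝ≥0}

/-- The cost of the closed loop in excess of the cost of the competing input. -/
noncomputable def gap (c : TransientComparison S β) : ℝ := S.Jcl c.N c.T c.z - S.J c.T (c.z 0) c.v

theorem exists_gap_le (hmin : S.HasMinimizers) (hterm : S.Terminal)
    (hbdd : Bornology.IsBounded (Prod.fst '' S.tight)) (hdiss : S.StrictDissipativity lam αℓ)
    (hval : S.ValueContinuity) : ∃ B : ℝ, ∀ c : TransientComparison S β, c.gap ≤ B := by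
  obtain ⟨D, hD⟩ := hval.exists_abs_sub_le hbdd
  obtain ⟨C, hC⟩ := hdiss.2.1
  refine ⟨2 * D + 2 * C, fun c => ?_⟩
  have hX := c.isClosedLoop.mem_XN hmin hterm c.one_le
  have hJcl := c.isClosedLoop.Jcl_le hmin hterm c.one_le c.T
  have hlam := lam_sub_le hdiss c.mem_admissibleToBall.1
  rw [gap]
  linarith [(abs_le.1 (hD _ c.one_le _ (hX 0))).2, (abs_le.1 (hD _ c.one_le _ (hX c.T))).1,
    (abs_le.1 (hC (c.z 0))).2, (abs_le.1 (hC (S.traj (c.z 0) c.v c.T))).1]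

theorem eventually_gap_le (hmin : S.HasMinimizers) (hterm : S.Terminal)
    (hbdd : Bornology.IsBounded (Prod.fst '' S.tight)) (hdiss : S.StrictDissipativity lam αℓ)
    (hlam : ContinuousAt lam S.zs) (hval : S.ValueContinuity) (hβ : IsClassKL β)
    (hconv : S.ConvergenceBound β) {ε : ℝ} (hε : 0 < ε) :
    ∀ᶠ c in comap (fun c : TransientComparison S β => min c.N c.T) atTop, c.gap ≤ ε := by
  obtain ⟨R, hR⟩ := exists_nnnorm_sub_zs_le hbdd
  obtain ⟨D, hD⟩ := hval.exists_abs_sub_le hbdd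
  have hnear := nearSteadyState_mem_nhds hterm hlam hval (by positivity : 0 < ε / 6)
  obtain ⟨K, hK⟩ := exists_lt_traj_mem hdiss hnear (2 * D)
  obtain ⟨w, hw⟩ := exists_tendsto_excessValue hmin hterm hbdd hdiss (zs_mem_XN hterm)
  obtain ⟨N₀, hN₀⟩ := eventually_atTop.1
    (hw.eventually (Metric.closedBall_mem_nhds w (by positivity : 0 < ε / 6)))
  obtain ⟨T₀, hT₀⟩ := eventually_atTop.1 (hβ.eventually_mem_of_norm_sub_le R hnear)
  filter_upwards [preimage_mem_comap (Ici_mem_atTop (N₀ + K + T₀))] with c hc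
  have hc : N₀ + K + T₀ ≤ c.N ∧ N₀ + K + T₀ ≤ c.T := le_min_iff.1 hc
  have hX := c.isClosedLoop.mem_XN hmin hterm c.one_le
  have hr : ‖c.z 0 - S.zs‖₊ ≤ R := hR c.N _ (hX 0)
  have hzT := hT₀ c.T (by omega) _ hr _ (hconv _ c.one_le _ c.isClosedLoop c.T)
  have hφT := hT₀ c.T (by omega) _ hr _ c.mem_admissibleToBall.2
  rw [gap]
  by_cases hJ : S.J c.T (c.z 0) c.v - c.T * S.ell (S.zs, S.vs) ≤ 2 * D
  · obtain ⟨P, hPK, hP⟩ := hK c.T (by omega) _ _ c.mem_admissibleToBall.1 hJ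
    have hgap := c.isClosedLoop.Jcl_sub_J_le_of_mem_nearSteadyState hmin hterm hdiss
      (by omega) (by omega) c.mem_admissibleToBall.1 hP hφT hzT
    linarith [(abs_le.1 (hN₀ (c.N - P) (by omega))).2, (abs_le.1 (hN₀ c.N (by omega))).1]
  · have hJcl := c.isClosedLoop.Jcl_le hmin hterm c.one_le c.T
    linarith [(abs_le.1 (hD _ c.one_le _ (hX 0))).2, (abs_le.1 (hD _ c.one_le _ (hX c.T))).1]

end TransientComparison

theorem exists_Jcl_le_iInf_add (hmin : S.HasMinimizers) (hterm : S.Terminal)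
    (hbdd : Bornology.IsBounded (Prod.fst '' S.tight)) (hdiss : S.StrictDissipativity lam αℓ)
    (hlam : ContinuousAt lam S.zs) (hval : S.ValueContinuity) {β : ℝ≥0 → ℝ≥0 → ℝ≥0}
    (hβ : IsClassKL β) (hconv : S.ConvergenceBound β) :
    ∃ δ : ℝ≥0 → ℝ≥0, IsClassL δ ∧
      ∀ N : ℕ, 1 ≤ N → ∀ T : ℕ, ∀ z : ℕ → EVec n, S.IsClosedLoop N z →
        ((S.Jcl N T z : ℝ) : EReal) ≤
          (⨅ v ∈ S.admissibleToBall (β ‖z 0 - S.zs‖₊ T) T (z 0),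
            ((S.J T (z 0) v : ℝ) : EReal)) +
          ((δ N : ℝ) : EReal) + ((δ T : ℝ) : EReal) := by
  obtain ⟨B, hB⟩ := TransientComparison.exists_gap_le (β := β) hmin hterm hbdd hdiss hval
  obtain ⟨δ, hδ, hle⟩ := exists_isClassL_majorant hB fun ε hε =>
    TransientComparison.eventually_gap_le hmin hterm hbdd hdiss hlam hval hβ hconv hε
  refine ⟨δ, hδ, fun N hN T z hz => ?_⟩
  rw [add_assoc, ← EReal.coe_add, ← EReal.sub_le_iff_le_add (Or.inl (EReal.coe_ne_bot _))
    (Or.inl (EReal.coe_ne_top _))]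
  refine le_iInf₂ fun v hv => ?_
  rw [← EReal.coe_sub, EReal.coe_le_coe_iff]
  have hgap : S.Jcl N T z - S.J T (z 0) v ≤ δ (min N T : ℕ) := hle ⟨N, T, z, v, hN, hz, hv⟩
  have hmin_le : (δ (min N T : ℕ) : ℝ) ≤ δ N + δ T := by
    rcases min_choice N T with h | h <;> rw [h]
    · exact le_add_of_nonneg_right (NNReal.coe_nonneg _)
    · exact le_add_of_nonneg_left (NNReal.coe_nonneg _)
  linarith

end TransientPerformance

end TubeMPC

theorem mainTheorem3_general {n m q : ℕ} (S : TubeMPC n m q)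
    (hmin : S.HasMinimizers)
    (hbdd : Bornology.IsBounded (Prod.fst '' S.tight))
    (hcost : ContinuousAt S.ell (S.zs, S.vs))
    (hterm : S.Terminal)
    (hross : S.ROSS)
    (lam : EVec n → ℝ) (αℓ : ℝ≥0 → ℝ≥0)
    (hdiss : S.StrictDissipativity lam αℓ)
    (hcldiss : S.ClosedLoopDissipativity lam αℓ)
    (hctrl : S.LocallyControllable)
    (hval : S.ValueContinuity) :
    (∃ β : ℝ≥0 → ℝ≥0 → ℝ≥0, IsClassKL β ∧ S.ConvergenceBound β) ∧
    ∀ β : ℝ≥0 → ℝ≥0 → ℝ≥0, IsClassKL β → S.ConvergenceBound β →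
      ∃ δ₁ δ₂ : ℝ≥0 → ℝ≥0, IsClassL δ₁ ∧ IsClassL δ₂ ∧
        ∀ N : ℕ, 1 ≤ N → ∀ T : ℕ, ∀ z : ℕ → EVec n, S.IsClosedLoop N z →
          ((S.Jcl N T z : ℝ) : EReal) ≤
            (⨅ v ∈ S.admissibleToBall (β ‖z 0 - S.zs‖₊ T) T (z 0),
              ((S.J T (z 0) v : ℝ) : EReal)) +
            ((δ₁ N : ℝ) : EReal) + ((δ₂ T : ℝ) : EReal) := by
  have hlam : ContinuousAt lam S.zs :=
    TubeMPC.continuousAt_lam hcost (mem_interior_iff_mem_nhds.1 hross.2.2) hdiss hctrl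
  refine ⟨TubeMPC.exists_convergenceBound hmin hterm hbdd hdiss hcldiss hlam hval,
    fun β hβ hconv => ?_⟩
  obtain ⟨δ, hδ, hle⟩ :=
    TubeMPC.exists_Jcl_le_iInf_add hmin hterm hbdd hdiss hlam hval hβ hconv
  exact ⟨δ, δ, hδ, hδ, hle⟩

theorem mainTheorem3 {n m q : ℕ} (S : TubeMPC n m q)
    (hmin : S.HasMinimizers)
    (hsets : S.ConstraintSets)
    (hrci : S.RCISet)
    (hcost : S.StageCost)
    (hterm : S.Terminal)
    (hross : S.ROSS)
    (lam : EVec n → ℝ) (αℓ : ℝ≥0 → ℝ≥0)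
    (hdiss : S.StrictDissipativity lam αℓ)
    (hcldiss : S.ClosedLoopDissipativity lam αℓ)
    (hreach : S.ExponentiallyReachable)
    (hctrl : S.LocallyControllable)
    (hval : S.ValueContinuity) :
    (∃ β : ℝ≥0 → ℝ≥0 → ℝ≥0, IsClassKL β ∧ S.ConvergenceBound β) ∧
    ∀ β : ℝ≥0 → ℝ≥0 → ℝ≥0, IsClassKL β → S.ConvergenceBound β →
      ∃ δ₁ δ₂ : ℝ≥0 → ℝ≥0, IsClassL δ₁ ∧ IsClassL δ₂ ∧
        ∀ N : ℕ, 1 ≤ N → ∀ T : ℕ, ∀ z : ℕ → EVec n, S.IsClosedLoop N z →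
          ((S.Jcl N T z : ℝ) : EReal) ≤
            (⨅ v ∈ S.admissibleToBall (β ‖z 0 - S.zs‖₊ T) T (z 0),
              ((S.J T (z 0) v : ℝ) : EReal)) +
            ((δ₁ N : ℝ) : EReal) + ((δ₂ T : ℝ) : EReal) := by
  exact mainTheorem3_general S hmin
    (TubeMPC.isBounded_fst_image_tight hsets.1.isBounded (hrci.2.1.mono interior_subset))
    (hcost.continuousAt_ell (mem_interior_iff_mem_nhds.1 hross.2.2)) hterm hross lam αℓ hdiss
    hcldiss hctrl hval
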